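/- Let $k\ge 1$ and, for $\sigma=(\sigma_1,\dots,\sigma_k)\in N:=\mathbb{C}^k$, put $\sigma_0:=1$ and $P_\sigma(z):=\sum_{h=0}^k(-1)^h\sigma_h z^{k-h}$. Let $A=A(\sigma)$ be the $k\times k$ matrix with entries $1$ immediately above the diagonal, with last row $(\tilde\sigma_k,\tilde\sigma_{k-1},\dots,\tilde\sigma_1)$, where $\tilde\sigma_h:=(-1)^{h-1}\sigma_h$, and with all other entries $0$. Let $f$ be an entire function on $\mathbb{C}$ and let $\Phi=(\varphi_0,\dots,\varphi_{k-1}):N\to\mathbb{C}^k$ be the vector Lisbon integral associated to $f$, $$\varphi_h(\sigma):=\frac{1}{2i\pi}\int_{|\zeta|=R} f(\zeta)\,\frac{\zeta^h\,d\zeta}{P_\sigma(\zeta)},\qquad 0\le h\le k-1,\quad R\gg\|\sigma\|.$$ Then $\Phi$ is a holomorphic solution on $N$ of the system $$(-1)^{k-h}\frac{\partial\Phi}{\partial\sigma_h}=\frac{\partial(A^{k-h}\Phi)}{\partial\sigma_k},\qquad h\in[1,k-1]\qquad (S\,3),$$ and the vector-valued $1$-form $dA\cdot\Phi$, whose $i$-th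 component is $\sum_j\varphi_j\,dA_{ij}$, is holomorphic and $d$-closed, and all its components except the last one vanish identically. Moreover $f$ has an entire primitive, and for every primitive $g$ of $f$ the last component of $dA\cdot\Phi$ is the differential $dF$ of the trace function $F=T(g)$ on $N$, $$T(g)(\sigma):=\sum_{P_\sigma(z_j)=0} g(z_j),$$ where the roots of $P_\sigma$ are counted with multiplicity. -/

import Mathlib

namespace Lisbon

open Polynomial

/-- The polynomial `P_σ(z) = z ^ k + ∑_{h=1}^{k} (-1) ^ h σ_h z ^ (k - h)`.  The coordinates
`σ_1, …, σ_k` of the point `σ` are stored as `σ 0, …, σ (k - 1)`, so the summand of index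
`i : Fin k` is the one with `h = i + 1`. -/
noncomputable def poly {k : ℕ} (σ : Fin k → ℂ) : ℂ[X] :=
  X ^ k + ∑ i : Fin k, C ((-1) ^ ((i : ℕ) + 1) * σ i) * X ^ (k - ((i : ℕ) + 1))

/-- A radius which is large compared with `σ`. -/
noncomputable def radius {k : ℕ} (σ : Fin k → ℂ) : ℝ := 1 + ∑ i, ‖σ i‖

/-- The `h`-th vector Lisbon integral of `f` at `σ`, over the circle of radius `R`:
`(2 i π)⁻¹ ∫_{|ζ| = R} f(ζ) ζ ^ h / P_σ(ζ) dζ`. -/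
noncomputable def circleLisbon {k : ℕ} (f : ℂ → ℂ) (σ : Fin k → ℂ) (R : ℝ) (h : ℕ) : ℂ :=
  (2 * (Real.pi : ℂ) * Complex.I)⁻¹ * ∮ ζ in C(0, R), f ζ * ζ ^ h / (poly σ).eval ζ

/-- The vector Lisbon integral `Φ = (φ_0, …, φ_{k-1})` associated to `f`. The radius of the circle
is immaterial as soon as it is large enough, see `vectorLisbon_eq`. -/
noncomputable def vectorLisbon {k : ℕ} (f : ℂ → ℂ) (σ : Fin k → ℂ) : Fin k → ℂ :=
  fun h => circleLisbon f σ (radius σ) h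

/-- The trace function `T(f)(σ) = ∑_{P_σ(z_j) = 0} f(z_j)`, roots counted with multiplicity. -/
noncomputable def traceFunction {k : ℕ} (f : ℂ → ℂ) (σ : Fin k → ℂ) : ℂ :=
  ((poly σ).roots.map f).sum

/-- The matrix `A` with `1` just above the diagonal, last row `(σ̃_k, σ̃_{k-1}, …, σ̃_1)` where
`σ̃_h = (-1) ^ (h - 1) σ_h`, and `0` elsewhere.  In column `j` (counted from `0`) of the last row
stands `σ̃_{k-j}`; as `σ_{k-j}` is stored at the index `k - j - 1 = j.rev`, this is
`(-1) ^ j.rev * σ j.rev`. -/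
noncomputable def matA {k : ℕ} (σ : Fin k → ℂ) : Matrix (Fin k) (Fin k) ℂ :=
  Matrix.of fun i j =>
    if (i : ℕ) + 1 = k then (-1) ^ (j.rev : ℕ) * σ j.rev
    else if (j : ℕ) = (i : ℕ) + 1 then 1 else 0

/-- The partial derivative `∂G / ∂σ_{i+1}`. -/
noncomputable def partialDeriv {k : ℕ} (i : Fin k) (G : (Fin k → ℂ) → Fin k → ℂ)
    (σ : Fin k → ℂ) : Fin k → ℂ :=
  fderiv ℂ G σ (Pi.single i 1)

/-- `Φ` is a global holomorphic solution of the system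
`(-1) ^ (k - h) ∂Φ/∂σ_h = ∂(A ^ (k - h) Φ)/∂σ_k` for `h ∈ [1, k - 1]` (here `h = i + 1`). -/
def IsSolutionS3 {k : ℕ} (hk : 1 ≤ k) (Φ : (Fin k → ℂ) → Fin k → ℂ) : Prop :=
  Differentiable ℂ Φ ∧
    ∀ i : Fin k, (i : ℕ) + 1 < k → ∀ σ : Fin k → ℂ,
      (-1 : ℂ) ^ (k - ((i : ℕ) + 1)) • partialDeriv i Φ σ =
        partialDeriv ⟨k - 1, Nat.sub_lt hk Nat.one_pos⟩
          (fun s => (matA s ^ (k - ((i : ℕ) + 1))).mulVec (Φ s)) σ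

/-- The vector valued `1`-form `dA · Φ`, whose `i`-th component is `∑_j φ_j dA_{ij}`. -/
noncomputable def dAForm {k : ℕ} (Φ : (Fin k → ℂ) → Fin k → ℂ) (σ : Fin k → ℂ) :
    (Fin k → ℂ) →L[ℂ] (Fin k → ℂ) :=
  ContinuousLinearMap.pi fun i => ∑ j, Φ σ j • fderiv ℂ (fun s : Fin k → ℂ => matA s i j) σ

/-- A holomorphic vector valued `1`-form on `ℂ ^ k` is closed if its exterior derivative vanishes. -/
def IsClosedHolomorphic {k : ℕ} (ω : (Fin k → ℂ) → (Fin k → ℂ) →L[ℂ] (Fin k → ℂ)) : Prop :=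
  Differentiable ℂ ω ∧
    extDeriv (fun σ => ContinuousAlternatingMap.ofSubsingleton ℂ (Fin k → ℂ) (Fin k → ℂ)
      (0 : Fin 1) (ω σ)) = 0

theorem eval_poly {k : ℕ} (σ : Fin k → ℂ) (z : ℂ) :
    (poly σ).eval z =
      z ^ k + ∑ i : Fin k, (-1) ^ ((i : ℕ) + 1) * σ i * z ^ (k - ((i : ℕ) + 1)) := by
  simp [poly, eval_finsetSum]

theorem eval_poly_ne_zero {k : ℕ} (σ : Fin k → ℂ) {z : ℂ} (hz : radius σ ≤ ‖z‖) :
    (poly σ).eval z ≠ 0 := by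
  have hS : 0 ≤ ∑ i, ‖σ i‖ := Finset.sum_nonneg fun i _ => norm_nonneg _
  have h1 : 1 ≤ ‖z‖ := by unfold radius at hz; linarith
  rw [eval_poly]
  intro h
  rcases Nat.eq_zero_or_pos k with rfl | hk
  · simp at h
  have h2 : ‖z‖ ^ k ≤ (∑ i, ‖σ i‖) * ‖z‖ ^ (k - 1) := by
    rw [← norm_pow, eq_neg_of_add_eq_zero_left h, norm_neg, Finset.sum_mul]
    refine (norm_sum_le _ _).trans (Finset.sum_le_sum fun i _ => ?_)
    rw [norm_mul, norm_mul, norm_pow, norm_pow, norm_neg, norm_one, one_pow, one_mul]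
    exact mul_le_mul_of_nonneg_left (pow_le_pow_right₀ h1 (by omega)) (norm_nonneg _)
  have h3 : ‖z‖ ^ k = ‖z‖ * ‖z‖ ^ (k - 1) := by
    rw [← pow_succ', Nat.sub_add_cancel hk]
  have h4 : 0 < ‖z‖ ^ (k - 1) := by positivity
  rw [h3] at h2
  have := le_of_mul_le_mul_right h2 h4
  unfold radius at hz
  linarith

/-- The vector Lisbon integral may be computed over any large circle. -/
theorem vectorLisbon_eq {k : ℕ} {f : ℂ → ℂ} (hf : Differentiable ℂ f) (σ : Fin k → ℂ) {R : ℝ}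
    (hR : radius σ ≤ R) (h : Fin k) : vectorLisbon f σ h = circleLisbon f σ R h := by
  have hS : 0 ≤ ∑ i, ‖σ i‖ := Finset.sum_nonneg fun i _ => norm_nonneg _
  have h0 : 0 < radius σ := by unfold radius; linarith
  have hd : ∀ z : ℂ, radius σ ≤ ‖z‖ →
      DifferentiableAt ℂ (fun ζ => f ζ * ζ ^ (h : ℕ) / (poly σ).eval ζ) z := fun z hz =>
    ((hf z).mul (differentiableAt_id.pow _)).div (poly σ).differentiable.differentiableAt
      (eval_poly_ne_zero σ hz)
  unfold vectorLisbon circleLisbon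
  congr 1
  symm
  refine Complex.circleIntegral_eq_of_differentiable_on_annulus_off_countable h0 hR
    Set.countable_empty (fun z hz => ?_) (fun z hz => ?_)
  · exact (hd z (by simpa using hz.2)).continuousAt.continuousWithinAt
  · refine hd z ?_
    have := hz.1.2
    simp only [Metric.mem_closedBall, dist_zero_right, not_le] at this
    exact this.le

end Lisbon

/-!
Everything is read off from contour integrals over a circle `|ζ| = R` which contains the roots of
`P_s` for all `s` near a given `σ`, so that one may differentiate under the integral sign
(`hasFDerivAt_circleIntegral`). The partial derivatives come from
`∂P_σ(ζ)/∂σ_h = (-1) ^ h ζ ^ (k - h)`.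

*The system.* Since `∮ f P_σ / P_σ = 0`, the companion matrix `A` acts on Lisbon integrals as
multiplication of `f` by `ζ` (`matA_mulVec_vectorLisbon`). Hence the component of index `m` of
`A ^ p Φ` is `(2iπ)⁻¹ ∮ f(ζ) ζ ^ (m + p) / P_σ(ζ) dζ`, and both sides of the equation of index `h`
equal `(-1) ^ (k - 1) (2iπ)⁻¹ ∮ f(ζ) ζ ^ (m + k - h) / P_σ(ζ) ^ 2 dζ`
(`isSolutionS3_vectorLisbon`).

*The form.* Only the last row of `A` depends on `σ`, so only the last component of `dA · Φ`
survives, and it is `∑_h (-1) ^ (h - 1) φ_{k-h} dσ_h`. By the residue theorem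
`T(g) = (2iπ)⁻¹ ∮ g P_σ' / P_σ dζ`. Differentiating in `σ` and integrating by parts in `ζ` gives
`dT(g) = -(2iπ)⁻¹ ∮ g' dP_σ / P_σ dζ` (`hasFDerivAt_traceFunction`), which is the same form when
`g' = f`. A primitive exists because `ℂ` is simply connected, and closedness of `dA · Φ` is then the
symmetry of the second derivative of `T(g)` (`isClosedHolomorphic_dAForm_vectorLisbon`).
-/

namespace Lisbon

open Polynomial Metric Topology Complex

/-! ### Circle integrals depending on a parameter -/

/-- Differentiation under the integral sign for circle integrals. Joint continuity of the derivative
and local compactness of the parameter space provide the dominating constant. -/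
theorem hasFDerivAt_circleIntegral {H : Type*} [NormedAddCommGroup H] [NormedSpace ℂ H]
    [LocallyCompactSpace H] {F : H → ℂ → ℂ} {F' : H → ℂ → H →L[ℂ] ℂ} {s : Set H} {x₀ : H}
    {c : ℂ} {R : ℝ} (hR : 0 ≤ R) (hs : s ∈ 𝓝 x₀)
    (hF : ∀ x ∈ s, ContinuousOn (F x) (sphere c R))
    (hF' : ContinuousOn (fun p : H × ℂ => F' p.1 p.2) (s ×ˢ sphere c R))
    (hd : ∀ x ∈ s, ∀ ζ ∈ sphere c R, HasFDerivAt (fun y => F y ζ) (F' x ζ) x) :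
    HasFDerivAt (fun x => ∮ ζ in C(c, R), F x ζ) (∮ ζ in C(c, R), F' x₀ ζ) x₀ := by
  obtain ⟨K, hK, hKs, hKc⟩ := local_compact_nhds hs
  obtain ⟨B, hB⟩ := (hKc.prod (isCompact_sphere c R)).exists_bound_of_continuousOn
    (hF'.mono (Set.prod_mono hKs le_rfl))
  have hmem : ∀ θ, circleMap c R θ ∈ sphere c R := circleMap_mem_sphere c hR
  have hcd : Continuous fun θ => deriv (circleMap c R) θ := by
    simp only [deriv_circleMap]; fun_prop
  have hx₀ : x₀ ∈ s := mem_of_mem_nhds hs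
  have hcont : ∀ x ∈ s, Continuous fun θ => deriv (circleMap c R) θ • F x (circleMap c R θ) :=
    fun x hx => hcd.smul ((hF x hx).comp_continuous (continuous_circleMap c R) hmem)
  have hcont' : Continuous fun θ => deriv (circleMap c R) θ • F' x₀ (circleMap c R θ) :=
    hcd.smul (hF'.comp_continuous (f := fun θ => (x₀, circleMap c R θ)) (by fun_prop)
      fun θ => ⟨hx₀, hmem θ⟩)
  refine intervalIntegral.hasFDerivAt_integral_of_dominated_of_fderiv_le (bound := fun _ => |R| * B)
    (F' := fun x θ => deriv (circleMap c R) θ • F' x (circleMap c R θ)) hK ?_ ?_ ?_ ?_ ?_ ?_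
  · filter_upwards [hs] with x hx using (hcont x hx).aestronglyMeasurable
  · exact (hcont x₀ hx₀).intervalIntegrable _ _
  · exact hcont'.aestronglyMeasurable
  · refine .of_forall fun θ _ x hx => ?_
    rw [norm_smul]
    have : ‖deriv (circleMap c R) θ‖ = |R| := by simp [deriv_circleMap]
    rw [this]
    exact mul_le_mul_of_nonneg_left (hB (x, _) ⟨hx, hmem θ⟩) (abs_nonneg R)
  · exact intervalIntegrable_const
  · exact .of_forall fun θ _ x hx => (hd x (hKs hx) _ (hmem θ)).fun_const_smul _

theorem circleIntegral_clm_apply {H : Type*} [NormedAddCommGroup H] [NormedSpace ℂ H]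
    {L : ℂ → H →L[ℂ] ℂ} {c : ℂ} {R : ℝ} (hR : 0 ≤ R) (hL : ContinuousOn L (sphere c R)) (v : H) :
    (∮ ζ in C(c, R), L ζ) v = ∮ ζ in C(c, R), L ζ v := by
  unfold circleIntegral
  rw [ContinuousLinearMap.intervalIntegral_apply (hL.circleIntegrable hR).out]
  rfl

/-- The residue theorem for the sum of the functions `g(ζ) / (ζ - r)`, `r` in a multiset of points
inside the circle. -/
theorem circleIntegral_mul_sum_inv {g : ℂ → ℂ} (hg : Differentiable ℂ g) {R : ℝ} (hR : 0 ≤ R)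
    (s : Multiset ℂ) (hs : ∀ r ∈ s, ‖r‖ < R) :
    (∮ ζ in C(0, R), g ζ * (s.map fun r => 1 / (ζ - r)).sum) =
      2 * Real.pi * Complex.I * (s.map g).sum := by
  have hne : ∀ r : ℂ, ‖r‖ < R → ∀ ζ ∈ sphere (0 : ℂ) R, ζ - r ≠ 0 := by
    intro r hr ζ hζ h
    rw [sub_eq_zero.mp h] at hζ
    simp only [mem_sphere_iff_norm, sub_zero] at hζ
    linarith
  have hc1 : ∀ r : ℂ, ‖r‖ < R → ContinuousOn (fun ζ => 1 / (ζ - r)) (sphere 0 R) := fun r hr =>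
    continuousOn_const.div (by fun_prop) (hne r hr)
  have hc : ∀ s : Multiset ℂ, (∀ r ∈ s, ‖r‖ < R) →
      ContinuousOn (fun ζ => (s.map fun r => 1 / (ζ - r)).sum) (sphere 0 R) := by
    intro s
    induction s using Multiset.induction_on with
    | empty => intro _; simpa using continuousOn_const
    | cons r s ih =>
      intro h
      simp only [Multiset.map_cons, Multiset.sum_cons]
      exact (hc1 r (h r (by simp))).add (ih fun q hq => h q (by simp [hq]))
  induction s using Multiset.induction_on with
  | empty => simp [circleIntegral]
  | cons r s ih =>
    have hs' : ∀ q ∈ s, ‖q‖ < R := fun q hq => hs q (by simp [hq])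
    have hr := hs r (by simp)
    simp only [Multiset.map_cons, Multiset.sum_cons, mul_add]
    have h1 : CircleIntegrable (fun ζ => g ζ * (1 / (ζ - r))) 0 R :=
      (hg.continuous.continuousOn.mul (hc1 r hr)).circleIntegrable hR
    have h2 : CircleIntegrable (fun ζ => g ζ * (s.map fun r => 1 / (ζ - r)).sum) 0 R :=
      (hg.continuous.continuousOn.mul (hc s hs')).circleIntegrable hR
    rw [circleIntegral.integral_add h1 h2, ih hs']
    congr 1
    simpa only [mul_one_div] using circleIntegral_div_sub_of_differentiable_on_off_countable
      Set.countable_empty (by simpa using hr) hg.continuous.continuousOn fun z _ => hg z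

/-! ### The polynomial as a function of its coefficients -/

/-- The linear part of `σ ↦ P_σ(ζ)`: the form `∑_h (-1) ^ h ζ ^ (k - h) dσ_h`. -/
noncomputable def evalForm (k : ℕ) (ζ : ℂ) : (Fin k → ℂ) →L[ℂ] ℂ :=
  ∑ i : Fin k, ((-1) ^ ((i : ℕ) + 1) * ζ ^ (k - ((i : ℕ) + 1))) • ContinuousLinearMap.proj i

/-- The linear part of `σ ↦ P_σ'(ζ)`, which is the derivative of `evalForm` with respect to `ζ`. -/
noncomputable def derivForm (k : ℕ) (ζ : ℂ) : (Fin k → ℂ) →L[ℂ] ℂ :=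
  ∑ i : Fin k, ((-1) ^ ((i : ℕ) + 1) *
    ((k - ((i : ℕ) + 1) : ℕ) * ζ ^ (k - ((i : ℕ) + 1) - 1))) • ContinuousLinearMap.proj i

variable {k : ℕ}

theorem evalForm_apply (ζ : ℂ) (v : Fin k → ℂ) :
    evalForm k ζ v = ∑ i : Fin k, (-1) ^ ((i : ℕ) + 1) * ζ ^ (k - ((i : ℕ) + 1)) * v i := by
  simp [evalForm]

theorem evalForm_single (ζ : ℂ) (i : Fin k) :
    evalForm k ζ (Pi.single i 1) = (-1) ^ ((i : ℕ) + 1) * ζ ^ (k - ((i : ℕ) + 1)) := by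
  simp [evalForm_apply, Pi.single_apply]

theorem continuous_evalForm : Continuous (evalForm k) := by
  unfold evalForm; fun_prop

theorem continuous_derivForm : Continuous (derivForm k) := by
  unfold derivForm; fun_prop

theorem hasDerivAt_evalForm (v : Fin k → ℂ) (ζ : ℂ) :
    HasDerivAt (fun z => evalForm k z v) (derivForm k ζ v) ζ := by
  simp only [evalForm_apply, derivForm, sum_apply,
    smul_apply, ContinuousLinearMap.proj_apply, smul_eq_mul]
  exact HasDerivAt.fun_sum fun i _ => ((hasDerivAt_pow _ ζ).const_mul _).mul_const _

theorem eval_poly_eq (σ : Fin k → ℂ) (ζ : ℂ) :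
    (poly σ).eval ζ = ζ ^ k + evalForm k ζ σ := by
  rw [eval_poly, evalForm_apply]
  congr 1
  exact Finset.sum_congr rfl fun i _ => by ring

theorem eval_derivative_poly (σ : Fin k → ℂ) (ζ : ℂ) :
    (poly σ).derivative.eval ζ = k * ζ ^ (k - 1) + derivForm k ζ σ := by
  refine (poly σ).hasDerivAt ζ |>.unique ?_
  simp only [eval_poly_eq]
  exact (hasDerivAt_pow k ζ).add (hasDerivAt_evalForm σ ζ)

theorem hasFDerivAt_eval_poly (σ : Fin k → ℂ) (ζ : ℂ) :
    HasFDerivAt (fun s : Fin k → ℂ => (poly s).eval ζ) (evalForm k ζ) σ := by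
  simp only [eval_poly_eq]
  exact (evalForm k ζ).hasFDerivAt.const_add _

theorem hasFDerivAt_eval_derivative_poly (σ : Fin k → ℂ) (ζ : ℂ) :
    HasFDerivAt (fun s : Fin k → ℂ => (poly s).derivative.eval ζ) (derivForm k ζ) σ := by
  simp only [eval_derivative_poly]
  exact (derivForm k ζ).hasFDerivAt.const_add _

theorem continuous_eval_poly :
    Continuous fun p : (Fin k → ℂ) × ℂ => (poly p.1).eval p.2 := by
  simp only [eval_poly]; fun_prop

theorem continuous_eval_derivative_poly :
    Continuous fun p : (Fin k → ℂ) × ℂ => (poly p.1).derivative.eval p.2 := by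
  simp only [eval_derivative_poly]
  exact (by fun_prop : Continuous fun p : (Fin k → ℂ) × ℂ => (k : ℂ) * p.2 ^ (k - 1)).add
    ((continuous_derivForm.comp continuous_snd).clm_apply continuous_fst)

theorem radius_pos (σ : Fin k → ℂ) : 0 < radius σ := by
  have : 0 ≤ ∑ i, ‖σ i‖ := Finset.sum_nonneg fun i _ => norm_nonneg _
  unfold radius; linarith

theorem eval_poly_ne_zero_of_mem_sphere {σ : Fin k → ℂ} {R : ℝ} (hR : radius σ ≤ R) {ζ : ℂ}
    (hζ : ζ ∈ sphere (0 : ℂ) R) : (poly σ).eval ζ ≠ 0 :=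
  eval_poly_ne_zero σ (by rw [mem_sphere_iff_norm, sub_zero] at hζ; rwa [hζ])

theorem setOf_radius_le_mem_nhds {σ : Fin k → ℂ} {R : ℝ} (hR : radius σ < R) :
    {s : Fin k → ℂ | radius s ≤ R} ∈ 𝓝 σ := by
  have hc : Continuous fun s : Fin k → ℂ => radius s := by unfold radius; fun_prop
  exact (hc.continuousAt.eventually_lt_const hR).mono fun s hs => hs.le

theorem poly_ne_zero (σ : Fin k → ℂ) : poly σ ≠ 0 := by
  intro h
  have := eval_poly_ne_zero σ (z := (radius σ : ℂ))
    (by rw [Complex.norm_real]; exact le_abs_self _)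
  simp [h] at this

theorem norm_lt_radius_of_mem_roots {σ : Fin k → ℂ} {r : ℂ} (hr : r ∈ (poly σ).roots) :
    ‖r‖ < radius σ := by
  by_contra! h
  exact eval_poly_ne_zero σ h ((mem_roots (poly_ne_zero σ)).1 hr)

/-! ### The Lisbon integrals -/

theorem circleLisbon_mul_pow (f : ℂ → ℂ) (σ : Fin k → ℂ) (R : ℝ) (p m : ℕ) :
    circleLisbon (fun ζ => ζ ^ p * f ζ) σ R m = circleLisbon f σ R (m + p) := by
  unfold circleLisbon
  congr 2
  funext ζ
  ring

theorem circleLisbon_radius_eq (hk : 1 ≤ k) {f : ℂ → ℂ} (hf : Differentiable ℂ f)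
    {σ : Fin k → ℂ} {R : ℝ} (hR : radius σ ≤ R) (m : ℕ) :
    circleLisbon f σ (radius σ) m = circleLisbon f σ R m := by
  have h := vectorLisbon_eq (f := fun ζ => ζ ^ m * f ζ) (by fun_prop) σ hR ⟨0, hk⟩
  simpa [vectorLisbon, circleLisbon_mul_pow] using h

/-- The integral `(2iπ)⁻¹ ∮ f(ζ) ζ ^ n / P_σ(ζ) ^ 2 dζ` over `|ζ| = R`, in terms of which
the first partial derivatives of the Lisbon integrals are expressed. -/
noncomputable def circleLisbonSq (f : ℂ → ℂ) (σ : Fin k → ℂ) (R : ℝ) (n : ℕ) : ℂ :=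
  (2 * (Real.pi : ℂ) * Complex.I)⁻¹ * ∮ ζ in C(0, R), f ζ * ζ ^ n / (poly σ).eval ζ ^ 2

theorem hasFDerivAt_circleIntegral_div_poly {N : ℂ → ℂ} (hN : Continuous N) {σ : Fin k → ℂ} {R : ℝ}
    (hR : radius σ < R) :
    HasFDerivAt (fun s : Fin k → ℂ => ∮ ζ in C(0, R), N ζ / (poly s).eval ζ)
      (∮ ζ in C(0, R), (-(N ζ / (poly σ).eval ζ ^ 2)) • evalForm k ζ) σ := by
  refine hasFDerivAt_circleIntegral (F' := fun s ζ => (-(N ζ / (poly s).eval ζ ^ 2)) • evalForm k ζ)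
    ((radius_pos σ).trans hR).le (setOf_radius_le_mem_nhds hR) (fun s hs => ?_) ?_
    fun s hs ζ hζ => ?_
  · exact hN.continuousOn.div (poly s).continuous.continuousOn fun ζ hζ =>
      eval_poly_ne_zero_of_mem_sphere hs hζ
  · refine ContinuousOn.smul (ContinuousOn.neg (ContinuousOn.div
      (hN.comp continuous_snd).continuousOn (continuous_eval_poly.pow 2).continuousOn ?_))
      (continuous_evalForm.comp continuous_snd).continuousOn
    exact fun p hp => pow_ne_zero 2 (eval_poly_ne_zero_of_mem_sphere hp.1 hp.2)
  · have h0 := eval_poly_ne_zero_of_mem_sphere hs hζ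
    have := ((hasDerivAt_inv h0).comp_hasFDerivAt s (hasFDerivAt_eval_poly s ζ)).const_mul (N ζ)
    simp only [div_eq_mul_inv]
    convert! this using 1
    rw [smul_smul]
    congr 1
    ring

theorem hasFDerivAt_circleLisbon (hk : 1 ≤ k) {f : ℂ → ℂ} (hf : Differentiable ℂ f)
    {σ : Fin k → ℂ} {R : ℝ} (hR : radius σ < R) (m : ℕ) :
    HasFDerivAt (fun s : Fin k → ℂ => circleLisbon f s (radius s) m)
      ((2 * (Real.pi : ℂ) * Complex.I)⁻¹ •
        ∮ ζ in C(0, R), (-(f ζ * ζ ^ m / (poly σ).eval ζ ^ 2)) • evalForm k ζ) σ := by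
  have h := (hasFDerivAt_circleIntegral_div_poly (N := fun ζ => f ζ * ζ ^ m)
    (by have := hf.continuous; fun_prop) hR).const_mul (2 * (Real.pi : ℂ) * Complex.I)⁻¹
  refine h.congr_of_eventuallyEq ?_
  filter_upwards [setOf_radius_le_mem_nhds hR] with s hs
  exact circleLisbon_radius_eq hk hf hs m

theorem fderiv_circleLisbon_single (hk : 1 ≤ k) {f : ℂ → ℂ} (hf : Differentiable ℂ f)
    {σ : Fin k → ℂ} {R : ℝ} (hR : radius σ < R) (m : ℕ) (i : Fin k) :
    fderiv ℂ (fun s : Fin k → ℂ => circleLisbon f s (radius s) m) σ (Pi.single i 1) =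
      (-1) ^ (i : ℕ) * circleLisbonSq f σ R (m + (k - ((i : ℕ) + 1))) := by
  have hR0 := ((radius_pos σ).trans hR).le
  have hL : ContinuousOn (fun ζ => (-(f ζ * ζ ^ m / (poly σ).eval ζ ^ 2)) • evalForm k ζ)
      (sphere 0 R) := by
    have hN : Continuous fun ζ => f ζ * ζ ^ m := by have := hf.continuous; fun_prop
    exact (hN.continuousOn.div ((poly σ).continuous.pow 2).continuousOn fun ζ hζ =>
      pow_ne_zero 2 (eval_poly_ne_zero_of_mem_sphere hR.le hζ)).neg.smul
      continuous_evalForm.continuousOn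
  rw [(hasFDerivAt_circleLisbon hk hf hR m).fderiv, smul_apply,
    circleIntegral_clm_apply hR0 hL, circleLisbonSq, smul_eq_mul, mul_left_comm]
  congr 1
  rw [← circleIntegral.integral_const_mul]
  congr 1
  funext ζ
  simp only [smul_apply, evalForm_single, smul_eq_mul]
  ring

theorem differentiable_circleLisbon (hk : 1 ≤ k) {f : ℂ → ℂ} (hf : Differentiable ℂ f) (m : ℕ) :
    Differentiable ℂ fun s : Fin k → ℂ => circleLisbon f s (radius s) m := fun σ =>
  (hasFDerivAt_circleLisbon hk hf (lt_add_one (radius σ)) m).differentiableAt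

theorem differentiable_vectorLisbon (hk : 1 ≤ k) {f : ℂ → ℂ} (hf : Differentiable ℂ f) :
    Differentiable ℂ (vectorLisbon f : (Fin k → ℂ) → Fin k → ℂ) :=
  differentiable_pi.2 fun h => differentiable_circleLisbon hk hf h

/-- Integrating `f · P_σ / P_σ = f` gives zero; solving for the top power of `ζ` in `P_σ` yields the
recursion between the Lisbon integrals. -/
theorem sum_mul_circleLisbon {f : ℂ → ℂ} (hf : Differentiable ℂ f) {σ : Fin k → ℂ} {R : ℝ}
    (hR : radius σ ≤ R) :
    ∑ j : Fin k, (-1) ^ (j.rev : ℕ) * σ j.rev * circleLisbon f σ R j = circleLisbon f σ R k := by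
  have hR0 : 0 ≤ R := (radius_pos σ).le.trans hR
  have hci : ∀ m : ℕ, CircleIntegrable (fun ζ => f ζ * ζ ^ m / (poly σ).eval ζ) 0 R := fun m =>
    ContinuousOn.circleIntegrable hR0 (ContinuousOn.div
      (by have := hf.continuous; fun_prop) (poly σ).continuous.continuousOn
      fun ζ hζ => eval_poly_ne_zero_of_mem_sphere hR hζ)
  have hci' : ∀ j : Fin k, CircleIntegrable
      (fun ζ => (-1) ^ (j.rev : ℕ) * σ j.rev * (f ζ * ζ ^ (j : ℕ) / (poly σ).eval ζ)) 0 R :=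
    fun j => (hci j).const_mul _
  have h0 : (∮ ζ in C(0, R), f ζ) = 0 :=
    circleIntegral_eq_zero_of_differentiable_on_off_countable hR0 Set.countable_empty
      hf.continuous.continuousOn fun z _ => hf z
  have h1 : (∮ ζ in C(0, R), f ζ) = ∮ ζ in C(0, R), (f ζ * ζ ^ k / (poly σ).eval ζ -
      ∑ j : Fin k, (-1) ^ (j.rev : ℕ) * σ j.rev * (f ζ * ζ ^ (j : ℕ) / (poly σ).eval ζ)) := by
    refine circleIntegral.integral_congr hR0 fun ζ hζ => ?_
    have hP := eval_poly_ne_zero_of_mem_sphere hR hζ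
    have hE : evalForm k ζ σ = -∑ j : Fin k, (-1) ^ (j.rev : ℕ) * σ j.rev * ζ ^ (j : ℕ) := by
      rw [evalForm_apply, ← Equiv.sum_comp Fin.revPerm, ← Finset.sum_neg_distrib]
      refine Finset.sum_congr rfl fun j _ => ?_
      have : k - ((j.rev : ℕ) + 1) = j := by rw [Fin.val_rev]; omega
      rw [Fin.revPerm_apply, this]
      ring
    have hsum : ∑ j : Fin k, (-1) ^ (j.rev : ℕ) * σ j.rev *
        (f ζ * ζ ^ (j : ℕ) / (poly σ).eval ζ) = f ζ / (poly σ).eval ζ * -evalForm k ζ σ := by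
      rw [hE, neg_neg, Finset.mul_sum]
      exact Finset.sum_congr rfl fun j _ => by ring
    simp only [hsum]
    rw [eval_poly_eq] at hP ⊢
    field_simp
    ring
  rw [circleIntegral.integral_sub (hci k)
    (CircleIntegrable.fun_sum _ fun j _ => hci' j),
    circleIntegral.integral_fun_sum fun j _ => hci' j, h0] at h1
  simp only [circleLisbon]
  rw [sub_eq_zero.1 h1.symm, Finset.mul_sum]
  refine Finset.sum_congr rfl fun j _ => ?_
  rw [circleIntegral.integral_const_mul]
  ring

/-- On Lisbon integrals, multiplication by the companion matrix `A` is multiplication of the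
integrand by `ζ`. -/
theorem matA_mulVec_vectorLisbon {f : ℂ → ℂ} (hf : Differentiable ℂ f) (σ : Fin k → ℂ) :
    (matA σ).mulVec (vectorLisbon f σ) = vectorLisbon (fun ζ => ζ * f ζ) σ := by
  have hshift : ∀ m : ℕ, circleLisbon (fun ζ => ζ * f ζ) σ (radius σ) m =
      circleLisbon f σ (radius σ) (m + 1) := by
    simpa using circleLisbon_mul_pow f σ (radius σ) 1
  funext i
  simp only [vectorLisbon, hshift, Matrix.mulVec, dotProduct, matA, Matrix.of_apply]
  by_cases hi : (i : ℕ) + 1 = k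
  · simp only [hi, if_true]
    exact sum_mul_circleLisbon hf le_rfl
  · have hlt : (i : ℕ) + 1 < k := by omega
    simp only [hi, if_false]
    rw [Finset.sum_eq_single ⟨i + 1, hlt⟩]
    · simp
    · intro j _ hj
      rw [if_neg (fun h => hj (Fin.ext h)), zero_mul]
    · simp

theorem matA_pow_mulVec_vectorLisbon {f : ℂ → ℂ} (hf : Differentiable ℂ f) (σ : Fin k → ℂ)
    (p : ℕ) (m : Fin k) :
    (matA σ ^ p).mulVec (vectorLisbon f σ) m = circleLisbon f σ (radius σ) (m + p) := by
  have h : (matA σ ^ p).mulVec (vectorLisbon f σ) = vectorLisbon (fun ζ => ζ ^ p * f ζ) σ := by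
    induction p with
    | zero => simp
    | succ p ih =>
      rw [pow_succ', ← Matrix.mulVec_mulVec, ih, matA_mulVec_vectorLisbon (by fun_prop)]
      simp only [pow_succ', mul_assoc]
  rw [h, vectorLisbon, circleLisbon_mul_pow]

/-- Component `m` of both sides of the equation of index `h` is, up to the factor `(-1) ^ (k - 1)`,
the integral of `f(ζ) ζ ^ (m + k - h) / P_σ(ζ) ^ 2`. -/
theorem isSolutionS3_vectorLisbon (hk : 1 ≤ k) {f : ℂ → ℂ} (hf : Differentiable ℂ f) :
    IsSolutionS3 hk (vectorLisbon f) := by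
  refine ⟨differentiable_vectorLisbon hk hf, fun i hi σ => ?_⟩
  have hR := lt_add_one (radius σ)
  funext m
  have hpd : ∀ (G : (Fin k → ℂ) → Fin k → ℂ) (n : ℕ) (l : Fin k),
      (∀ s m, G s m = circleLisbon f s (radius s) (m + n)) →
      partialDeriv l G σ m =
        (-1) ^ (l : ℕ) * circleLisbonSq f σ (radius σ + 1) (m + n + (k - ((l : ℕ) + 1))) := by
    intro G n l hG
    have hG' : G = fun s (m : Fin k) => circleLisbon f s (radius s) (m + n) := by
      funext s m; exact hG s m
    rw [partialDeriv, hG', ← fderiv_circleLisbon_single hk hf hR, fderiv_pi fun h =>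
      differentiable_circleLisbon hk hf _ σ]
    rfl
  rw [Pi.smul_apply, smul_eq_mul, hpd (vectorLisbon f) 0 i fun s m => rfl,
    hpd _ (k - ((i : ℕ) + 1)) ⟨k - 1, _⟩ fun s m => matA_pow_mulVec_vectorLisbon hf s _ m,
    ← mul_assoc, ← pow_add]
  have h1 : k - ((i : ℕ) + 1) + i = k - 1 := by omega
  have h2 : (m : ℕ) + (k - ((i : ℕ) + 1)) + (k - (k - 1 + 1)) = m + 0 + (k - ((i : ℕ) + 1)) := by
    omega
  simp only [h1, h2]

/-! ### The trace function -/

theorem traceFunction_eq_circleIntegral {g : ℂ → ℂ} (hg : Differentiable ℂ g) {σ : Fin k → ℂ}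
    {R : ℝ} (hR : radius σ ≤ R) :
    traceFunction g σ = (2 * (Real.pi : ℂ) * Complex.I)⁻¹ *
      ∮ ζ in C(0, R), g ζ * (poly σ).derivative.eval ζ / (poly σ).eval ζ := by
  have hR0 : 0 ≤ R := (radius_pos σ).le.trans hR
  have h : (∮ ζ in C(0, R), g ζ * (poly σ).derivative.eval ζ / (poly σ).eval ζ) =
      ∮ ζ in C(0, R), g ζ * ((poly σ).roots.map fun r => 1 / (ζ - r)).sum :=
    circleIntegral.integral_congr hR0 fun ζ hζ => by
      rw [mul_div_assoc, (IsAlgClosed.splits (poly σ)).eval_derivative_div_eval_of_ne_zero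
        (eval_poly_ne_zero_of_mem_sphere hR hζ)]
  rw [h, circleIntegral_mul_sum_inv hg hR0 _ fun r hr =>
    (norm_lt_radius_of_mem_roots hr).trans_le hR, inv_mul_cancel_left₀ two_pi_I_ne_zero]
  rfl

/-- The differential of `T(g)` is `-(2iπ)⁻¹ ∫ g'(ζ) dP_σ(ζ) / P_σ(ζ)`: differentiate
`∫ g P_σ' / P_σ` under the integral sign and integrate by parts in `ζ`. -/
theorem hasFDerivAt_traceFunction {f g : ℂ → ℂ} (hf : Continuous f)
    (hg : ∀ z, HasDerivAt g (f z) z) {σ : Fin k → ℂ} {R : ℝ} (hR : radius σ < R) :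
    HasFDerivAt (traceFunction g) ((2 * (Real.pi : ℂ) * Complex.I)⁻¹ •
      ∮ ζ in C(0, R), (-(f ζ / (poly σ).eval ζ)) • evalForm k ζ) σ := by
  have hR0 := ((radius_pos σ).trans hR).le
  have hgd : Differentiable ℂ g := fun z => (hg z).differentiableAt
  have hgc := hgd.continuous
  let F' : (Fin k → ℂ) → ℂ → (Fin k → ℂ) →L[ℂ] ℂ := fun s ζ =>
    (g ζ / (poly s).eval ζ ^ 2) • ((poly s).eval ζ • derivForm k ζ -
      (poly s).derivative.eval ζ • evalForm k ζ)
  have hF'c : ContinuousOn (fun p : (Fin k → ℂ) × ℂ => F' p.1 p.2)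
      ({s : Fin k → ℂ | radius s ≤ R} ×ˢ sphere 0 R) := by
    refine ContinuousOn.smul (ContinuousOn.div (hgc.comp continuous_snd).continuousOn
      (continuous_eval_poly.pow 2).continuousOn fun p hp =>
        pow_ne_zero 2 (eval_poly_ne_zero_of_mem_sphere hp.1 hp.2)) (Continuous.continuousOn ?_)
    exact (continuous_eval_poly.smul (continuous_derivForm.comp continuous_snd)).sub
      (continuous_eval_derivative_poly.smul (continuous_evalForm.comp continuous_snd))
  have hI : HasFDerivAt
      (fun s : Fin k → ℂ => ∮ ζ in C(0, R), g ζ * (poly s).derivative.eval ζ / (poly s).eval ζ)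
      (∮ ζ in C(0, R), F' σ ζ) σ := by
    refine hasFDerivAt_circleIntegral hR0 (setOf_radius_le_mem_nhds hR) (fun s hs => ?_) hF'c
      fun s hs ζ hζ => ?_
    · exact (hgc.mul (poly s).derivative.continuous).continuousOn.div
        (poly s).continuous.continuousOn fun ζ hζ => eval_poly_ne_zero_of_mem_sphere hs hζ
    · have h0 := eval_poly_ne_zero_of_mem_sphere hs hζ
      have := ((hasFDerivAt_eval_derivative_poly s ζ).const_mul (g ζ)).mul
        ((hasDerivAt_inv h0).comp_hasFDerivAt s (hasFDerivAt_eval_poly s ζ))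
      simp only [div_eq_mul_inv]
      convert! this using 1
      ext v
      simp only [F', smul_apply, sub_apply,
        add_apply, smul_eq_mul, Function.comp_apply]
      field_simp
      ring
  have hparts : (∮ ζ in C(0, R), F' σ ζ) =
      ∮ ζ in C(0, R), (-(f ζ / (poly σ).eval ζ)) • evalForm k ζ := by
    have hF'σ : ContinuousOn (F' σ) (sphere 0 R) :=
      hF'c.comp (f := fun ζ => (σ, ζ)) (by fun_prop) fun ζ hζ => ⟨hR.le, hζ⟩
    have hLc : ContinuousOn (fun ζ => (-(f ζ / (poly σ).eval ζ)) • evalForm k ζ) (sphere 0 R) :=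
      ((hf.continuousOn.div (poly σ).continuous.continuousOn fun ζ hζ =>
        eval_poly_ne_zero_of_mem_sphere hR.le hζ).neg).smul continuous_evalForm.continuousOn
    ext1 v
    rw [circleIntegral_clm_apply hR0 hF'σ, circleIntegral_clm_apply hR0 hLc, ← sub_eq_zero,
      ← circleIntegral.integral_sub
        ((hF'σ.clm_apply continuousOn_const).circleIntegrable hR0)
        ((hLc.clm_apply continuousOn_const).circleIntegrable hR0)]
    -- The difference of the integrands is the derivative of `g dP_σ(v) / P_σ`.
    refine circleIntegral.integral_eq_zero_of_hasDerivWithinAt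
      (f := fun ζ => g ζ * evalForm k ζ v / (poly σ).eval ζ) hR0 fun ζ hζ => ?_
    have h0 := eval_poly_ne_zero_of_mem_sphere hR.le hζ
    have := ((hg ζ).mul (hasDerivAt_evalForm v ζ)).div ((poly σ).hasDerivAt ζ) h0
    refine HasDerivAt.hasDerivWithinAt (this.congr_deriv ?_)
    simp only [F', smul_apply, sub_apply, smul_eq_mul, Pi.mul_apply]
    field_simp
    ring
  rw [← hparts]
  refine (hI.const_mul _).congr_of_eventuallyEq ?_
  filter_upwards [setOf_radius_le_mem_nhds hR] with s hs
  exact traceFunction_eq_circleIntegral hgd hs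

/-! ### The form `dA · Φ` -/

theorem hasFDerivAt_matA (σ : Fin k → ℂ) (i j : Fin k) :
    HasFDerivAt (fun s : Fin k → ℂ => matA s i j)
      (if (i : ℕ) + 1 = k then (-1) ^ (j.rev : ℕ) •
        (ContinuousLinearMap.proj j.rev : (Fin k → ℂ) →L[ℂ] ℂ) else 0) σ := by
  simp only [matA, Matrix.of_apply]
  split_ifs
  · have := (hasFDerivAt_apply (𝕜 := ℂ) j.rev σ).const_mul ((-1) ^ (j.rev : ℕ))
    convert! this using 1
    ext v
    simp
  all_goals exact hasFDerivAt_const _ _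

theorem dAForm_apply (Φ : (Fin k → ℂ) → Fin k → ℂ) (σ v : Fin k → ℂ) (i : Fin k) :
    dAForm Φ σ v i =
      if (i : ℕ) + 1 = k then ∑ j : Fin k, Φ σ j * ((-1) ^ (j.rev : ℕ) * v j.rev) else 0 := by
  simp only [dAForm, (hasFDerivAt_matA σ _ _).fderiv]
  split_ifs with hi <;> simp [hi]

theorem differentiable_dAForm {Φ : (Fin k → ℂ) → Fin k → ℂ} (hΦ : Differentiable ℂ Φ) :
    Differentiable ℂ (dAForm Φ) := by
  have h : dAForm Φ = fun σ => ∑ i : Fin k, (ContinuousLinearMap.compL ℂ _ _ _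
      (ContinuousLinearMap.single ℂ (fun _ : Fin k => ℂ) i)) (∑ j : Fin k, Φ σ j •
        (fderiv ℂ (fun s : Fin k → ℂ => matA s i j) 0)) := by
    funext σ
    ext1 v
    funext i
    simp [dAForm, (hasFDerivAt_matA _ _ _).fderiv, Finset.sum_apply, Pi.single_apply]
  rw [h]
  have := differentiable_pi.1 hΦ
  fun_prop

/-- The last component of `dA · Φ` is the differential of the trace of a primitive of `f`. -/
theorem hasFDerivAt_traceFunction_dAForm {f g : ℂ → ℂ} (hf : Differentiable ℂ f)
    (hg : ∀ z, HasDerivAt g (f z) z) (σ : Fin k → ℂ) {l : Fin k} (hl : (l : ℕ) + 1 = k) :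
    HasFDerivAt (traceFunction g)
      ((ContinuousLinearMap.proj l).comp (dAForm (vectorLisbon f) σ)) σ := by
  have hk : 1 ≤ k := by omega
  have hR := lt_add_one (radius σ)
  set R := radius σ + 1
  have hR0 := ((radius_pos σ).trans hR).le
  refine (hasFDerivAt_traceFunction hf.continuous hg hR).congr_fderiv ?_
  have hLc : ContinuousOn (fun ζ => (-(f ζ / (poly σ).eval ζ)) • evalForm k ζ) (sphere 0 R) :=
    ((hf.continuous.continuousOn.div (poly σ).continuous.continuousOn fun ζ hζ =>
      eval_poly_ne_zero_of_mem_sphere hR.le hζ).neg).smul continuous_evalForm.continuousOn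
  -- Compare the values on the basis vector of index `j`, that is, the partial derivatives with
  -- respect to `σ_{j+1}`.
  refine ContinuousLinearMap.coe_injective (LinearMap.pi_ext' fun j => LinearMap.ext_ring ?_)
  have hj : k - ((j : ℕ) + 1) = j.rev := by rw [Fin.val_rev]
  simp only [LinearMap.comp_apply, LinearMap.single_apply, ContinuousLinearMap.coe_coe,
    ContinuousLinearMap.comp_apply, smul_apply, ContinuousLinearMap.proj_apply,
    dAForm_apply, hl, if_true, circleIntegral_clm_apply hR0 hLc, evalForm_single, smul_eq_mul]
  rw [Finset.sum_eq_single j.rev]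
  · rw [Fin.rev_rev, Pi.single_eq_same, mul_one, vectorLisbon, circleLisbon_radius_eq hk hf hR.le,
      circleLisbon, hj, mul_assoc _ _ ((-1 : ℂ) ^ (j : ℕ)), mul_comm _ ((-1 : ℂ) ^ (j : ℕ))]
    congr 1
    rw [← circleIntegral.integral_const_mul]
    congr 1
    funext ζ
    ring
  · intro i _ hi
    rw [Pi.single_eq_of_ne (fun h => hi (by rw [← h, Fin.rev_rev])), mul_zero, mul_zero]
  · simp

/-- If the derivative of `G` is itself differentiable, then it is closed as a `1`-form: this is the
symmetry of the second derivative, for which continuity is not needed. -/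
theorem extDeriv_ofSubsingleton_eq_zero {E F : Type*} [NormedAddCommGroup E] [NormedSpace ℂ E]
    [NormedAddCommGroup F] [NormedSpace ℂ F] {G : E → F} {ω : E → E →L[ℂ] F}
    (hG : ∀ x, HasFDerivAt G (ω x) x) (hω : Differentiable ℂ ω) :
    extDeriv (fun x => ContinuousAlternatingMap.ofSubsingleton ℂ E F (0 : Fin 1) (ω x)) = 0 := by
  funext x
  have hd : DifferentiableAt ℂ
      (fun x => ContinuousAlternatingMap.ofSubsingleton ℂ E F (0 : Fin 1) (ω x)) x :=
    (ContinuousAlternatingMap.ofSubsingletonLIE (𝕜 := ℂ) (E := E) (F := F)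
      (0 : Fin 1)).differentiable.differentiableAt.comp x (hω x)
  ext v
  have hap : ∀ w y : E, fderiv ℂ (fun x => ω x w) x y = fderiv ℂ ω x y w := fun w y => by
    rw [fderiv_clm_apply (hω x) (differentiableAt_const w)]
    simp
  rw [extDeriv_apply hd]
  simp [Fin.sum_univ_two, hap, Fin.removeNth,
    second_derivative_symmetric hG (hω x).hasFDerivAt (v 0) (v 1)]

/-- The form `dA · Φ` is the differential of the map with components `(0, …, 0, T(g))`. -/
theorem isClosedHolomorphic_dAForm_vectorLisbon (hk : 1 ≤ k) {f g : ℂ → ℂ}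
    (hf : Differentiable ℂ f) (hg : ∀ z, HasDerivAt g (f z) z) :
    IsClosedHolomorphic (dAForm (vectorLisbon f : (Fin k → ℂ) → Fin k → ℂ)) := by
  have hd := differentiable_dAForm (differentiable_vectorLisbon hk hf)
  refine ⟨hd, extDeriv_ofSubsingleton_eq_zero
    (G := fun σ (i : Fin k) => if (i : ℕ) + 1 = k then traceFunction g σ else 0) (fun σ => ?_) hd⟩
  refine hasFDerivAt_pi'.2 fun i => ?_
  split_ifs with hi
  · exact hasFDerivAt_traceFunction_dAForm hf hg σ hi
  · refine (hasFDerivAt_const (0 : ℂ) σ).congr_fderiv ?_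
    ext1 v
    simp [dAForm_apply, hi]

end Lisbon

theorem corollary3 (k : ℕ) (hk : 1 ≤ k) (f : ℂ → ℂ) (hf : Differentiable ℂ f)
    (Φ : (Fin k → ℂ) → Fin k → ℂ) (hΦ : Φ = Lisbon.vectorLisbon f) :
    Lisbon.IsSolutionS3 hk Φ ∧
    Lisbon.IsClosedHolomorphic (Lisbon.dAForm Φ) ∧
    (∀ (σ v : Fin k → ℂ) (i : Fin k), (i : ℕ) + 1 < k → Lisbon.dAForm Φ σ v i = 0) ∧
    (∃ g : ℂ → ℂ, ∀ z, HasDerivAt g (f z) z) ∧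
    (∀ g : ℂ → ℂ, (∀ z, HasDerivAt g (f z) z) → ∀ σ : Fin k → ℂ,
      HasFDerivAt (Lisbon.traceFunction g)
        ((ContinuousLinearMap.proj (⟨k - 1, Nat.sub_lt hk Nat.one_pos⟩ : Fin k)).comp
          (Lisbon.dAForm Φ σ)) σ) := by
  subst hΦ
  obtain ⟨g, hg'⟩ := hf.isExactOn_univ
  have hg : ∀ z, HasDerivAt g (f z) z := fun z => hg' z (Set.mem_univ z)
  refine ⟨Lisbon.isSolutionS3_vectorLisbon hk hf,
    Lisbon.isClosedHolomorphic_dAForm_vectorLisbon hk hf hg, fun σ v i hi => ?_, ⟨g, hg⟩,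
    fun g hg σ => Lisbon.hasFDerivAt_traceFunction_dAForm hf hg σ (Nat.sub_add_cancel hk)⟩
  rw [Lisbon.dAForm_apply, if_neg hi.ne]
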